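/- **Theorem 1.** Let $n\ge 0$, let $F_n$ be the free group with basis $x_1,\dots,x_n$, and let $\varphi\in\mathrm{Aut}(F_n)$ be virtually inner, i.e. $\varphi^m$ is an inner automorphism of $F_n$ for some integer $m\neq 0$. Call two words $U,V$ in the letters $x_1^{\pm1},\dots,x_n^{\pm1}$ (not necessarily reduced) $\varphi$-twisted conjugate if there is an $X\in F_n$ such that $\varphi(X)\,U=V\,X$ holds in $F_n$. Then the $\varphi$-twisted conjugacy problem in $F_n$ is solvable: there is an algorithm (which may depend on $n$ and $\varphi$) that, given any two words $U,V$, decides whether they are $\varphi$-twisted conjugate. Moreover, there is a computable normal form for $\varphi$-twisted conjugacy: a computable map $V\mapsto\overline V$ from words to reduced words such that, for all words $U,V$, the word $\overline V$ is $\varphi$-twisted conjugate to $V$, and $U$ and $V$ are $\varphi$-twisted conjugate if and only if $\overline U$ and $\overline V$ are the same word. -/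

import Mathlib

/-- Group words of rank `n`: finite, not necessarily reduced sequences of letters `x_i^{±1}`.
The letter `(i, true)` is `x_i` and `(i, false)` is its inverse; `FreeGroup.mk U` is the element
of the free group `F_n = FreeGroup (Fin n)` that the word `U` represents. -/
abbrev GroupWord (n : ℕ) : Type := List (Fin n × Bool)

/-- An automorphism is virtually inner if some non-zero power of it is an inner automorphism
(`MulAut.conj g` is `x ↦ g * x * g⁻¹`). -/
def IsVirtuallyInner {G : Type*} [Group G] (φ : MulAut G) : Prop :=
  ∃ m : ℤ, m ≠ 0 ∧ φ ^ m ∈ (MulAut.conj : G →* MulAut G).range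

/-- The words `U` and `V` are `φ`-twisted conjugate: the equation `φ(X) U = V X` has a solution
`X` in the free group. -/
def TwistedConjugate {n : ℕ} (φ : MulAut (FreeGroup (Fin n))) (U V : GroupWord n) : Prop :=
  ∃ X : FreeGroup (Fin n), φ X * FreeGroup.mk U = FreeGroup.mk V * X

/-- The `H`-twisted conjugacy problem in `F_n` is solvable: there is an algorithm (a total
recursive function) deciding, for any two words `U`, `V`, whether they are `φ`-twisted conjugate
for some `φ ∈ H`. -/
def TwistedConjugacyProblemSolvable {n : ℕ} (H : Set (MulAut (FreeGroup (Fin n)))) : Prop :=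
  ComputablePred fun p : GroupWord n × GroupWord n => ∃ φ ∈ H, TwistedConjugate φ p.1 p.2

/-- `nf` is a normal form for `φ`-twisted conjugacy: it chooses in every `φ`-twisted conjugacy
class one reduced word, so that two words are `φ`-twisted conjugate if and only if their normal
forms coincide letter by letter. -/
structure IsTwistedNormalForm {n : ℕ} (φ : MulAut (FreeGroup (Fin n)))
    (nf : GroupWord n → GroupWord n) : Prop where
  reduced : ∀ V, FreeGroup.IsReduced (nf V)
  conjugate : ∀ V, TwistedConjugate φ (nf V) V
  eq_iff : ∀ U V, nf U = nf V ↔ TwistedConjugate φ U V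

/-! Arrange that φ^m is conjugation by some g with φ g = g. Let t act on F_n as φ; in F_n ⋊ ⟨t⟩ the
element g⁻¹t^m is central, and φ(X)U = VX says that X conjugates U⁻¹t to V⁻¹t. Up to the central
factor, the m-th power of U⁻¹t is u = `twistedPow φ U⁻¹ m * g`, so every solution X conjugates u to
v, the element formed likewise from V.

If u ≠ 1, the map y ↦ U⁻¹φ(y)U fixes u, hence its cyclic centralizer (`map_eq_of_commute`). Two
elements conjugating u to v differ by that centralizer, so testing one of them settles the question
(`map_mul_eq_of_twistedPow_ne`).

If u = 1, the affine map y ↦ U⁻¹φ(y) behaves like a finite-order isometry of a tree. A quasi-center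
of its orbit is moved a bounded distance, so U is twisted conjugate to a word of bounded length
(`exists_norm_twisted_conj_le`). Only finitely many classes occur, and a finite table compares them.

Thus both twisted conjugacy and its negation have searchable certificates
(`not_twistedConjugate_iff`), and the relation is decidable. The normal form is the first reduced
word of the class in a fixed enumeration. -/

namespace FreeGroup

/-! ### The Cayley tree and bounded cancellation. -/

section WordMetric

variable {α : Type*} [DecidableEq α]

/-- The word metric of the free group, whose Cayley graph is a tree. -/
def wordDist (x y : FreeGroup α) : ℕ := norm (x⁻¹ * y)

/-- `y` lies on the geodesic from `x` to `z` in the Cayley tree. -/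
def Between (x y z : FreeGroup α) : Prop := wordDist x y + wordDist y z = wordDist x z

theorem wordDist_comm (x y : FreeGroup α) : wordDist x y = wordDist y x := by
  unfold wordDist
  rw [← norm_inv_eq]
  simp

theorem wordDist_self (x : FreeGroup α) : wordDist x x = 0 := by
  simp [wordDist]

theorem wordDist_triangle (x y z : FreeGroup α) : wordDist x z ≤ wordDist x y + wordDist y z := by
  unfold wordDist
  calc norm (x⁻¹ * z) = norm ((x⁻¹ * y) * (y⁻¹ * z)) := by group
    _ ≤ _ := norm_mul_le _ _

theorem wordDist_mul_left (a x y : FreeGroup α) : wordDist (a * x) (a * y) = wordDist x y := by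
  unfold wordDist
  congr 1
  group

theorem eq_of_wordDist_eq_zero {x y : FreeGroup α} (h : wordDist x y = 0) : x = y := by
  rw [wordDist, norm_eq_zero] at h
  exact (inv_mul_eq_one.mp h)

/-- Lengths add exactly when nothing cancels at the junction. Geometrically, 1 separates a from b
iff they lie in different directions from 1. -/
theorem norm_inv_mul_eq_add_iff {a b : FreeGroup α} :
    norm (a⁻¹ * b) = norm a + norm b ↔ ∀ s ∈ a.toWord.head?, s ∉ b.toWord.head? := by
  constructor
  · intro h s ha hb
    obtain ⟨la, hla⟩ : ∃ l, a.toWord = s :: l := by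
      cases ha' : a.toWord <;> simp_all
    obtain ⟨lb, hlb⟩ : ∃ l, b.toWord = s :: l := by
      cases hb' : b.toWord <;> simp_all
    have ha1 : a = mk [s] * mk la := by
      rw [mul_mk, List.singleton_append, ← hla, mk_toWord]
    have hb1 : b = mk [s] * mk lb := by
      rw [mul_mk, List.singleton_append, ← hlb, mk_toWord]
    have h1 : a⁻¹ * b = (mk la)⁻¹ * mk lb := by rw [ha1, hb1]; group
    have h2 : norm (a⁻¹ * b) ≤ la.length + lb.length := by
      rw [h1]
      refine (norm_mul_le _ _).trans ?_
      rw [norm_inv_eq]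
      exact add_le_add norm_mk_le norm_mk_le
    have h3 : norm a = la.length + 1 := by simp [norm, hla]
    have h4 : norm b = lb.length + 1 := by simp [norm, hlb]
    omega
  · intro h
    have hred : IsReduced (invRev a.toWord ++ b.toWord) := by
      unfold IsReduced
      rw [List.isChain_append]
      refine ⟨?_, isReduced_toWord, ?_⟩
      · rw [← toWord_inv]
        exact isReduced_toWord
      · intro s hs t ht hst
        simp only [invRev, List.getLast?_reverse, List.head?_map] at hs
        cases ha : a.toWord.head? with
        | none => simp [ha] at hs
        | some r =>
          rw [ha] at hs
          simp only [Option.map_some, Option.mem_def, Option.some.injEq] at hs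
          by_contra hne
          refine h r (by simp [ha]) ?_
          have : r = t := by
            subst hs
            ext1
            · exact hst
            · simpa using hne
          rw [this]
          exact ht
    rw [norm, toWord_mul, toWord_inv, hred.reduce_eq, List.length_append, invRev_length]
    rfl

/-- In a tree, a point of a geodesic `[c, c']` lies on `[c, p]` or on `[c', p]`, for any `p`. -/
theorem Between.or {c z c' : FreeGroup α} (h : Between c z c') (p : FreeGroup α) :
    Between c z p ∨ Between c' z p := by
  -- Seen from z, betweenness means different directions; p cannot share its direction with both c
  -- and c'.
  have key : ∀ x y : FreeGroup α, Between x z y ↔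
      ∀ s ∈ (z⁻¹ * x).toWord.head?, s ∉ (z⁻¹ * y).toWord.head? := by
    intro x y
    rw [← norm_inv_mul_eq_add_iff, Between, wordDist_comm x z, wordDist, wordDist, wordDist]
    have : (z⁻¹ * x)⁻¹ * (z⁻¹ * y) = x⁻¹ * y := by group
    rw [this]
    exact eq_comm
  rw [key] at h ⊢
  rw [key]
  by_contra! hcon
  obtain ⟨⟨s, hs, hs'⟩, t, ht, ht'⟩ := hcon
  have : s = t := Option.mem_unique hs' ht'
  subst this
  exact h s hs ht

theorem exists_geodesic (x y : FreeGroup α) : ∃ w : ℕ → FreeGroup α,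
    w 0 = x ∧ w (wordDist x y) = y ∧ (∀ k, wordDist (w k) (w (k + 1)) ≤ 1) ∧
    ∀ k ≤ wordDist x y, wordDist x (w k) = k ∧ wordDist (w k) y = wordDist x y - k := by
  set L := (x⁻¹ * y).toWord with hL
  have hlen : wordDist x y = L.length := rfl
  have hy : x * mk L = y := by rw [hL, mk_toWord]; group
  have hstep : ∀ k, wordDist (x * mk (L.take k)) (x * mk (L.take (k + 1))) ≤ 1 := by
    intro k
    rw [wordDist_mul_left, List.take_add_one, ← mul_mk]
    unfold wordDist
    rw [inv_mul_cancel_left]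
    refine norm_mk_le.trans ?_
    cases L[k]? <;> simp
  have h1 : ∀ k, wordDist x (x * mk (L.take k)) ≤ k := by
    intro k
    unfold wordDist
    rw [inv_mul_cancel_left]
    refine norm_mk_le.trans ?_
    simp
  have h2 : ∀ k ≤ wordDist x y, wordDist (x * mk (L.take k)) y ≤ wordDist x y - k := by
    intro k hk
    have : y = x * mk (L.take k) * mk (L.drop k) := by
      rw [mul_assoc, mul_mk, List.take_append_drop, hy]
    unfold wordDist
    nth_rewrite 1 [this]
    rw [inv_mul_cancel_left]
    refine norm_mk_le.trans ?_
    rw [List.length_drop]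
    exact le_of_eq (by rw [← hlen]; rfl)
  refine ⟨fun k => x * mk (L.take k), ?_, ?_, hstep, ?_⟩
  · simp [← one_eq_mk]
  · simp only [hlen, List.take_length, hy]
  · intro k hk
    have := wordDist_triangle x (x * mk (L.take k)) y
    have := h1 k
    have := h2 k hk
    dsimp only
    omega

theorem exists_midpoint (x y : FreeGroup α) : ∃ z, Between x z y ∧
    wordDist x y ≤ 2 * wordDist x z + 1 ∧ wordDist x y ≤ 2 * wordDist z y + 1 := by
  obtain ⟨w, -, -, -, hw⟩ := exists_geodesic x y
  obtain ⟨h1, h2⟩ := hw (wordDist x y / 2) (by omega)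
  refine ⟨w (wordDist x y / 2), ?_, ?_, ?_⟩
  · unfold Between; omega
  · omega
  · omega

theorem exists_norm_map_le [Finite α] (θ : FreeGroup α →* FreeGroup α) :
    ∃ K, ∀ x, norm (θ x) ≤ K * norm x := by
  cases nonempty_fintype α
  refine ⟨∑ i, norm (θ (of i)), fun x => ?_⟩
  set K := ∑ i, norm (θ (of i)) with hK
  have hle : ∀ i, norm (θ (of i)) ≤ K := fun i =>
    Finset.single_le_sum (f := fun i => norm (θ (of i))) (fun _ _ => Nat.zero_le _)
      (Finset.mem_univ i)
  have hlist : ∀ L : List (α × Bool), norm (θ (mk L)) ≤ K * L.length := by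
    intro L
    induction L with
    | nil => simp [← one_eq_mk]
    | cons s L ih =>
      have h1 : mk (s :: L) = mk [s] * mk L := by rw [mul_mk]; rfl
      have h2 : norm (θ (mk [s])) ≤ K := by
        obtain ⟨i, b⟩ := s
        cases b
        · have : mk [(i, false)] = (of i)⁻¹ := by simp [of, inv_mk, invRev]
          rw [this, _root_.map_inv, norm_inv_eq]
          exact hle i
        · exact hle i
      rw [h1, _root_.map_mul]
      refine (norm_mul_le _ _).trans ?_
      rw [List.length_cons, mul_add, mul_one]
      omega
  have := hlist x.toWord
  rwa [mk_toWord] at this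

theorem exists_wordDist_map_le [Finite α] (θ : FreeGroup α →* FreeGroup α) :
    ∃ K, ∀ x y, wordDist (θ x) (θ y) ≤ K * wordDist x y := by
  obtain ⟨K, hK⟩ := exists_norm_map_le θ
  refine ⟨K, fun x y => ?_⟩
  have := hK (x⁻¹ * y)
  rwa [_root_.map_mul, _root_.map_inv] at this

/-- Bounded cancellation: an automorphism maps geodesics uniformly close to geodesics. -/
theorem exists_bounded_cancellation [Finite α] (θ : MulAut (FreeGroup α)) :
    ∃ B, ∀ x y z, Between x y z →
      wordDist (θ x) (θ y) + wordDist (θ y) (θ z) ≤ wordDist (θ x) (θ z) + B := by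
  obtain ⟨K, hK⟩ := exists_wordDist_map_le θ.toMonoidHom
  obtain ⟨K', hK'⟩ := exists_wordDist_map_le θ.symm.toMonoidHom
  refine ⟨2 * (K * K'), fun x y z h => ?_⟩
  obtain ⟨w, h0, hL, hstep, hw⟩ := exists_geodesic (θ x) (θ z)
  by_cases hP0 : Between x y (θ.symm (w 0))
  · rw [h0, MulEquiv.symm_apply_apply] at hP0
    have : x = y := by
      apply eq_of_wordDist_eq_zero
      unfold Between at hP0
      rw [wordDist_self] at hP0
      omega
    subst this
    rw [wordDist_self]
    omega
  -- Pull the geodesic from θ x to θ z back by θ⁻¹ and stop at its first point that y separates from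
  -- x.
  · have hex : ∃ k, Between x y (θ.symm (w k)) :=
      ⟨wordDist (θ x) (θ z), by rw [hL, MulEquiv.symm_apply_apply]; exact h⟩
    classical
    obtain ⟨k, hk⟩ : ∃ k, Nat.find hex = k + 1 := by
      refine Nat.exists_eq_succ_of_ne_zero fun h0' => hP0 ?_
      have := Nat.find_spec hex
      rwa [h0'] at this
    have hPk : Between x y (θ.symm (w (k + 1))) := hk ▸ Nat.find_spec hex
    have hnk : ¬ Between x y (θ.symm (w k)) := Nat.find_min hex (by omega)
    have hkL : k + 1 ≤ wordDist (θ x) (θ z) := by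
      rw [← hk]
      exact Nat.find_min' hex (by rw [hL, MulEquiv.symm_apply_apply]; exact h)
    -- The last step jumped across y, so y is within one step length K' of the pulled-back path, and
    -- θ y within K * K' of the geodesic.
    have hb := (hPk.or (θ.symm (w k))).resolve_left hnk
    have h1 : wordDist y (θ.symm (w k)) ≤ K' := by
      have h2 : wordDist (θ.symm (w k)) (θ.symm (w (k + 1))) ≤ K' * 1 :=
        (hK' _ _).trans (Nat.mul_le_mul_left _ (hstep k))
      unfold Between at hb
      rw [wordDist_comm (θ.symm (w (k + 1))) (θ.symm (w k))] at hb
      omega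
    have h2 : wordDist (θ y) (w k) ≤ K * K' := by
      have h3 : wordDist (θ y) (θ (θ.symm (w k))) ≤ K * wordDist y (θ.symm (w k)) := hK _ _
      rw [MulEquiv.apply_symm_apply] at h3
      exact h3.trans (Nat.mul_le_mul_left _ h1)
    obtain ⟨h3, h4⟩ := hw k (by omega)
    have h5 := wordDist_triangle (θ x) (w k) (θ y)
    have h6 := wordDist_triangle (θ y) (w k) (θ z)
    rw [wordDist_comm (w k) (θ y)] at h5
    omega

end WordMetric

end FreeGroup

/-! ### Twisted powers. -/

section TwistedNorm

variable {G : Type*} [Group G]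

/-- The twisted power `a * φ a * φ² a * ⋯` with `k` factors. -/
def twistedPow (φ : MulAut G) (a : G) : ℕ → G
  | 0 => 1
  | k + 1 => a * φ (twistedPow φ a k)

theorem twistedPow_succ' (φ : MulAut G) (a : G) (k : ℕ) :
    twistedPow φ a (k + 1) = twistedPow φ a k * (φ ^ k) a := by
  induction k with
  | zero => simp [twistedPow]
  | succ k ih =>
    calc a * φ (twistedPow φ a (k + 1)) = a * (φ (twistedPow φ a k) * φ ((φ ^ k) a)) := by
          rw [ih, map_mul]
      _ = a * φ (twistedPow φ a k) * (φ ^ (k + 1)) a := by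
          rw [pow_succ', MulAut.mul_apply, mul_assoc]

theorem twistedPow_conj (φ : MulAut G) (a c : G) (k : ℕ) :
    twistedPow φ (c⁻¹ * a * φ c) k = c⁻¹ * twistedPow φ a k * (φ ^ k) c := by
  induction k with
  | zero => simp [twistedPow]
  | succ k ih =>
    rw [twistedPow, ih, twistedPow, pow_succ', MulAut.mul_apply]
    simp only [map_mul, map_inv]
    group

/-- Since φ commutes with φ^m, all φ^k(g) induce the same inner automorphism, but they may differ by
central elements. Replacing m by m² and g by its m-th twisted power absorbs that difference,
whatever the center. -/
theorem IsVirtuallyInner.exists_fixed_conj {φ : MulAut G} (h : IsVirtuallyInner φ) :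
    ∃ (m : ℕ) (g : G), 0 < m ∧ φ ^ m = MulAut.conj g ∧ φ g = g := by
  obtain ⟨m, g, hm, hg⟩ : ∃ (m : ℕ) (g : G), 0 < m ∧ φ ^ m = MulAut.conj g := by
    obtain ⟨m, hm, g, hg⟩ := h
    obtain ⟨k, rfl | rfl⟩ := m.eq_nat_or_neg
    · exact ⟨k, g, by omega, by rw [hg, zpow_natCast]⟩
    · exact ⟨k, g⁻¹, by omega, by rw [map_inv, hg, zpow_neg, inv_inv, zpow_natCast]⟩
  have hconj : ∀ k : ℕ, MulAut.conj ((φ ^ k) g) = MulAut.conj g := by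
    intro k
    ext x
    have h1 : ∀ y, (φ ^ m) ((φ ^ k) y) = (φ ^ k) ((φ ^ m) y) := fun y => by
      rw [← MulAut.mul_apply, ← MulAut.mul_apply, ← pow_add, ← pow_add, add_comm]
    have h2 := h1 ((φ ^ k).symm x)
    rw [MulEquiv.apply_symm_apply, hg, MulAut.conj_apply, MulAut.conj_apply, map_mul, map_mul,
      map_inv, MulEquiv.apply_symm_apply] at h2
    rw [MulAut.conj_apply, MulAut.conj_apply, h2]
  have hpow : ∀ k : ℕ, MulAut.conj (twistedPow φ g k) = MulAut.conj g ^ k := by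
    intro k
    induction k with
    | zero => simp [twistedPow]
    | succ k ih => rw [twistedPow_succ', map_mul, ih, hconj, pow_succ]
  refine ⟨m * m, twistedPow φ g m, Nat.mul_pos hm hm, ?_, ?_⟩
  · rw [hpow, pow_mul, hg]
  · have h1 : g * φ (twistedPow φ g m) = twistedPow φ g m * (φ ^ m) g := twistedPow_succ' φ g m
    have h2 : (φ ^ m) g = g := by simp [hg]
    have h3 : MulAut.conj (twistedPow φ g m) g = g := by
      rw [hpow, ← hg, ← pow_mul]
      have : ∀ k : ℕ, (φ ^ (m * k)) g = g := by
        intro k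
        induction k with
        | zero => simp
        | succ k ih => rw [Nat.mul_succ, pow_add, MulAut.mul_apply, h2, ih]
      exact this m
    rw [MulAut.conj_apply, mul_inv_eq_iff_eq_mul] at h3
    rw [h2, h3] at h1
    exact mul_left_cancel h1

variable {φ : MulAut G} {m : ℕ} {g : G}

theorem twistedPow_mul_conj (hg : φ ^ m = MulAut.conj g) (a c : G) :
    twistedPow φ (c⁻¹ * a * φ c) m * g = c⁻¹ * (twistedPow φ a m * g) * c := by
  rw [twistedPow_conj, hg, MulAut.conj_apply]
  group

/-- In the semidirect product, a t commutes with its own m-th power. -/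
theorem twistedPow_mul_fixed (hg : φ ^ m = MulAut.conj g) (hφg : φ g = g) (a : G) :
    a * φ (twistedPow φ a m * g) * a⁻¹ = twistedPow φ a m * g := by
  have h := twistedPow_succ' φ a m
  rw [twistedPow, hg, MulAut.conj_apply] at h
  rw [map_mul, hφg, ← mul_assoc, h]
  group

end TwistedNorm

namespace FreeGroup

/-! ### Centralizers in free groups. -/

section Centralizer

universe u

variable {α : Type u}

/-- The subgroup generated by x and y is abelian, and free by Nielsen–Schreier, so it has at most
one free generator. -/
theorem exists_zpow_eq_of_commute {x y : FreeGroup α} (h : Commute x y) :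
    ∃ (z : FreeGroup α) (a b : ℤ), z ^ a = x ∧ z ^ b = y := by
  let H := Subgroup.closure ({x, y} : Set (FreeGroup α))
  have hcomm : ∀ p ∈ H, ∀ q ∈ H, p * q = q * p := by
    have hxy : ∀ s ∈ ({x, y} : Set (FreeGroup α)), ∀ t ∈ ({x, y} : Set (FreeGroup α)),
        s * t = t * s := by
      rintro s (rfl | rfl) t (rfl | rfl)
      · rfl
      · exact h.eq
      · exact h.eq.symm
      · rfl
    have := (Subgroup.isMulCommutative_closure hxy)
    intro p hp q hq
    exact congrArg Subtype.val (this.is_comm.comm ⟨p, hp⟩ ⟨q, hq⟩)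
  have hx : x ∈ H := Subgroup.subset_closure (by simp)
  have hy : y ∈ H := Subgroup.subset_closure (by simp)
  let e := IsFreeGroup.mulEquiv H
  have hsub : ∀ i j : IsFreeGroup.Generators H, i = j := by
    intro i j
    have h1 : e (of i) * e (of j) = e (of j) * e (of i) := Subtype.ext <|
      hcomm _ (e (of i)).2 _ (e (of j)).2
    rw [← _root_.map_mul, ← _root_.map_mul] at h1
    have h2 := e.injective h1
    classical
    have h3 := congrArg toWord h2
    by_contra hij
    simp [toWord_mul, reduce.cons, hij, Ne.symm hij] at h3
  have hcyc : ∃ z : FreeGroup (IsFreeGroup.Generators H), ∀ w, ∃ a : ℤ, z ^ a = w := by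
    by_cases hne : Nonempty (IsFreeGroup.Generators H)
    · obtain ⟨i⟩ := hne
      refine ⟨of i, fun w => ?_⟩
      induction w using FreeGroup.induction_on with
      | C1 => exact ⟨0, zpow_zero _⟩
      | of j => exact ⟨1, by rw [zpow_one, hsub i j]⟩
      | inv_of j _ => exact ⟨-1, by rw [zpow_neg_one, hsub i j]⟩
      | mul p q hp hq =>
        obtain ⟨a, rfl⟩ := hp
        obtain ⟨b, rfl⟩ := hq
        exact ⟨a + b, zpow_add _ _ _⟩
    · rw [not_nonempty_iff] at hne
      exact ⟨1, fun w => ⟨0, Subsingleton.elim _ _⟩⟩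
  obtain ⟨z, hz⟩ := hcyc
  obtain ⟨a, ha⟩ := hz (e.symm ⟨x, hx⟩)
  obtain ⟨b, hb⟩ := hz (e.symm ⟨y, hy⟩)
  refine ⟨(e z : FreeGroup α), a, b, ?_, ?_⟩
  · have := congrArg (fun t => (e t : FreeGroup α)) ha
    simpa using this
  · have := congrArg (fun t => (e t : FreeGroup α)) hb
    simpa using this

/-- An endomorphism that fixes `u ≠ 1` fixes the centralizer of `u`. -/
theorem map_eq_of_commute {ψ : FreeGroup α →* FreeGroup α} {r u : FreeGroup α} (hu : u ≠ 1)
    (hψ : ψ u = u) (hr : Commute r u) : ψ r = r := by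
  obtain ⟨z, a, b, rfl, rfl⟩ := exists_zpow_eq_of_commute hr
  have hb : b ≠ 0 := by
    rintro rfl
    exact hu (zpow_zero z)
  have hz : ψ z = z := by
    rw [_root_.map_zpow] at hψ
    exact zpow_left_injective hb hψ
  rw [_root_.map_zpow, hz]

end Centralizer

end FreeGroup

namespace FreeGroup

/-! ### Quasi-centers and the case of trivial twisted power. -/

section Quasicenter

variable {α : Type*} [DecidableEq α]

/-- The sum of the word metric over the first `m` iterates of an automorphism. -/
def wordDistSum (φ : MulAut (FreeGroup α)) (m : ℕ) (x y : FreeGroup α) : ℕ :=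
  ∑ i ∈ Finset.range m, wordDist ((φ ^ i) x) ((φ ^ i) y)

variable {φ : MulAut (FreeGroup α)} {m : ℕ}

theorem wordDistSum_triangle (x y z : FreeGroup α) :
    wordDistSum φ m x z ≤ wordDistSum φ m x y + wordDistSum φ m y z := by
  unfold wordDistSum
  rw [← Finset.sum_add_distrib]
  exact Finset.sum_le_sum fun i _ => wordDist_triangle _ _ _

theorem wordDist_le_wordDistSum (hm : 0 < m) (x y : FreeGroup α) :
    wordDist x y ≤ wordDistSum φ m x y :=
  Finset.single_le_sum (f := fun i => wordDist ((φ ^ i) x) ((φ ^ i) y))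
    (fun _ _ => Nat.zero_le _) (Finset.mem_range.mpr hm)

/-- The affine map shifts the summands by one; the new last term, for φ^m, replaces the term for φ^0
and exceeds it by at most 2|g|. -/
theorem wordDistSum_affine_le {g : FreeGroup α} (hg : φ ^ m = MulAut.conj g)
    (a x y : FreeGroup α) :
    wordDistSum φ m (a * φ x) (a * φ y) ≤ wordDistSum φ m x y + 2 * norm g := by
  have h1 : ∀ i, wordDist ((φ ^ i) (a * φ x)) ((φ ^ i) (a * φ y)) =
      wordDist ((φ ^ (i + 1)) x) ((φ ^ (i + 1)) y) := by
    intro i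
    rw [_root_.map_mul, _root_.map_mul, wordDist_mul_left, pow_succ, MulAut.mul_apply,
      MulAut.mul_apply]
  have h2 : wordDist ((φ ^ m) x) ((φ ^ m) y) ≤ wordDist x y + 2 * norm g := by
    rw [hg, MulAut.conj_apply, MulAut.conj_apply, mul_assoc, mul_assoc, wordDist_mul_left]
    unfold wordDist
    have : (x * g⁻¹)⁻¹ * (y * g⁻¹) = g * (x⁻¹ * y) * g⁻¹ := by group
    rw [this]
    have h3 := norm_mul_le (g * (x⁻¹ * y)) g⁻¹
    have h4 := norm_mul_le g (x⁻¹ * y)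
    rw [norm_inv_eq] at h3
    omega
  unfold wordDistSum
  simp_rw [h1]
  have h3 := Finset.sum_range_succ (fun i => wordDist ((φ ^ i) x) ((φ ^ i) y)) m
  rw [Finset.sum_range_succ'] at h3
  simp only [pow_zero, MulAut.one_apply] at h3
  omega

theorem exists_wordDistSum_between_or [Finite α] (φ : MulAut (FreeGroup α)) (m : ℕ) :
    ∃ B, ∀ c z c' p : FreeGroup α, Between c z c' →
      wordDistSum φ m c z + wordDistSum φ m z p ≤ wordDistSum φ m c p + B ∨
      wordDistSum φ m c' z + wordDistSum φ m z p ≤ wordDistSum φ m c' p + B := by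
  choose B hB using fun i : ℕ => exists_bounded_cancellation (φ ^ i)
  refine ⟨∑ i ∈ Finset.range m, B i, fun c z c' p h => ?_⟩
  unfold wordDistSum
  simp only [← Finset.sum_add_distrib]
  exact (h.or p).imp (fun h => Finset.sum_le_sum fun i _ => hB i _ _ _ h)
    fun h => Finset.sum_le_sum fun i _ => hB i _ _ _ h

/-- Up to twisted conjugacy there are only finitely many elements whose `m`-th twisted power is
`g⁻¹`: a quasi-center of the orbit of `1` under the affine map `y ↦ a * φ y` is moved a bounded
distance. -/
theorem exists_norm_twisted_conj_le [Finite α] {g : FreeGroup α} (hm : 0 < m)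
    (hg : φ ^ m = MulAut.conj g) :
    ∃ C, ∀ a, twistedPow φ a m * g = 1 → ∃ c, norm (c⁻¹ * a * φ c) ≤ C := by
  obtain ⟨B, hB⟩ := exists_wordDistSum_between_or φ m
  set E := 2 * norm g + wordDistSum φ m g⁻¹ 1 with hE
  refine ⟨2 * (E + B) + 1, fun a ha => ?_⟩
  let f : FreeGroup α → ℕ := fun x =>
    (Finset.range m).sup fun i => wordDistSum φ m x (twistedPow φ a i)
  have hle : ∀ x, ∀ i < m, wordDistSum φ m x (twistedPow φ a i) ≤ f x := fun x i hi =>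
    Finset.le_sup (f := fun i => wordDistSum φ m x (twistedPow φ a i)) (Finset.mem_range.mpr hi)
  have hmap : ∀ x, f (a * φ x) ≤ f x + E := by
    intro x
    refine Finset.sup_le fun i hi => ?_
    rw [Finset.mem_range] at hi
    have hstep : ∀ j < m, wordDistSum φ m (a * φ x) (twistedPow φ a (j + 1)) ≤
        f x + 2 * norm g := fun j hj =>
      (wordDistSum_affine_le hg _ _ _).trans (Nat.add_le_add_right (hle x j hj) _)
    cases i with
    | zero =>
      -- The orbit closes up at g⁻¹ instead of 1, whence the second summand of E.
      obtain ⟨k, rfl⟩ : ∃ k, m = k + 1 := ⟨m - 1, by omega⟩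
      have h1 := hstep k (by omega)
      rw [eq_inv_of_mul_eq_one_left ha] at h1
      have h2 := wordDistSum_triangle (φ := φ) (m := k + 1) (a * φ x) g⁻¹ (twistedPow φ a 0)
      rw [twistedPow] at h2 ⊢
      omega
    | succ j =>
      have := hstep j (by omega)
      omega
  -- A quasi-center: it minimizes the radius f of the orbit.
  obtain ⟨c, hc⟩ : ∃ c, ∀ x, f c ≤ f x :=
    ⟨Function.argmin f, fun x => Function.argmin_le f x⟩
  refine ⟨c, ?_⟩
  obtain ⟨z, hz, hz1, hz2⟩ := exists_midpoint c (a * φ c)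
  obtain ⟨i, hi, hfz⟩ := Finset.exists_mem_eq_sup (Finset.range m)
    (Finset.nonempty_range_iff.mpr hm.ne') fun i => wordDistSum φ m z (twistedPow φ a i)
  rw [Finset.mem_range] at hi
  have h0 : f z = wordDistSum φ m z (twistedPow φ a i) := hfz
  have h1 := hc z
  have h2 := hmap c
  have h3 := hle c i hi
  have h4 := hle (a * φ c) i hi
  have h5 := wordDist_le_wordDistSum (φ := φ) hm c z
  have h6 := wordDist_le_wordDistSum (φ := φ) hm (a * φ c) z
  rw [wordDist_comm (a * φ c) z] at h6
  have h7 : norm (c⁻¹ * a * φ c) = wordDist c (a * φ c) := by rw [wordDist, mul_assoc]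
  rw [h7]
  -- Moving to the midpoint z lowers the radius by about half of |c⁻¹aφ(c)|, up to E + B. Minimality
  -- at c therefore bounds that half by E + B.
  rcases hB c z (a * φ c) (twistedPow φ a i) hz with h | h <;> omega

end Quasicenter

/-! ### Conjugacy and cyclically reduced words. -/

section CyclicWords

variable {α : Type*}

theorem isCyclicallyReduced_iff_isReduced_append_self {L : List (α × Bool)} :
    IsCyclicallyReduced L ↔ IsReduced (L ++ L) := by
  unfold IsReduced
  rw [List.isChain_append, isCyclicallyReduced_iff]
  unfold IsReduced
  tauto

theorem IsCyclicallyReduced.rotate {L : List (α × Bool)} (h : IsCyclicallyReduced L) {s} {l}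
    (hL : L = s :: l) : IsCyclicallyReduced (l ++ [s]) := by
  subst hL
  rw [isCyclicallyReduced_iff] at h ⊢
  obtain ⟨h1, h2⟩ := h
  cases l with
  | nil => simp
  | cons t l =>
    unfold IsReduced at *
    rw [List.isChain_append]
    simp only [List.isChain_cons_cons] at h1
    refine ⟨⟨h1.2, by simp, ?_⟩, ?_⟩
    · simpa using h2
    · rw [List.getLast?_concat]
      simpa using h1.1

/-- Conjugate cyclically reduced words are rotations of each other. -/
theorem isRotated_of_mul_eq_mul {A B : List (α × Bool)} (hA : IsCyclicallyReduced A)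
    (hB : IsCyclicallyReduced B) {X : List (α × Bool)} (hX : IsReduced X)
    (h : mk X * mk A = mk B * mk X) : A ~r B := by
  classical
  induction X using List.reverseRecOn generalizing A with
  | nil =>
    simp only [← one_eq_mk, one_mul, mul_one] at h
    have := reduce.sound h
    rw [hA.isReduced.reduce_eq, hB.isReduced.reduce_eq] at this
    rw [this]
  | append_singleton X s ih =>
    have hX' : IsReduced X := hX.infix ⟨[], [s], by simp⟩
    have hconj : mk B = mk (X ++ [s]) * mk A * (mk (X ++ [s]))⁻¹ := by
      rw [h]; group
    rw [← mul_mk] at hconj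
    have hinv : (mk [s])⁻¹ = mk [(s.1, !s.2)] := by simp [inv_mk, invRev]
    -- If the last letter s of the conjugator cancels against either end of A, it only rotates A,
    -- and the conjugator shortens.
    by_cases h1 : A.head? = some (s.1, !s.2)
    · obtain ⟨l, rfl⟩ : ∃ l, A = (s.1, !s.2) :: l := List.head?_eq_some_iff.mp h1
      refine List.IsRotated.trans ⟨1, by simp⟩ (ih (hA.rotate rfl) hX' ?_)
      have hl : mk ((s.1, !s.2) :: l) = (mk [s])⁻¹ * mk l := by rw [hinv, mul_mk]; rfl
      rw [hconj, hl, ← mul_mk, ← hinv]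
      group
    by_cases h2 : A.getLast? = some s
    · obtain ⟨l, rfl⟩ : ∃ l, A = l ++ [s] := List.getLast?_eq_some_iff.mp h2
      have hrot : IsCyclicallyReduced (s :: l) := by
        rw [isCyclicallyReduced_iff] at hA ⊢
        obtain ⟨h3, h4⟩ := hA
        unfold IsReduced at *
        rw [List.isChain_append] at h3
        rw [List.isChain_cons]
        refine ⟨⟨?_, h3.1⟩, ?_⟩
        · intro t ht
          refine h4 s (by simp) t ?_
          cases l <;> simp_all
        · intro t ht r hr
          simp only [List.head?_cons, Option.mem_def, Option.some.injEq] at hr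
          subst hr
          cases l with
          | nil => simp_all
          | cons q l =>
            refine h3.2.2 t ?_ s (by simp)
            simpa [List.getLast?_cons_cons] using ht
      refine List.IsRotated.trans (List.IsRotated.symm ⟨1, by simp⟩) (ih hrot hX' ?_)
      have hl : mk (s :: l) = mk [s] * mk l := by rw [mul_mk]; rfl
      rw [hconj, hl, ← mul_mk]
      group
    · by_cases hne : A = []
      · subst hne
        rw [← one_eq_mk] at hconj
        have : mk B = mk [] := by rw [hconj, ← one_eq_mk]; group
        have := reduce.sound this
        rw [hB.isReduced.reduce_eq] at this
        rw [this, reduce_nil]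
      exfalso
      -- Without cancellation B is this word, whose first and last letters are inverse, so B is not
      -- cyclically reduced.
      have hred : IsReduced (X ++ [s] ++ A ++ invRev (X ++ [s])) := by
        have hXs : invRev (X ++ [s]) = (s.1, !s.2) :: invRev X := by simp [invRev]
        have hinvred : IsReduced (invRev (X ++ [s])) := by
          rw [isReduced_iff_reduce_eq, reduce_invRev, hX.reduce_eq]
        refine IsReduced.append_overlap ?_ ?_ hne
        · unfold IsReduced at *
          rw [List.isChain_append]
          refine ⟨hX, hA.isReduced, ?_⟩
          intro p hp q hq hpq
          simp only [List.getLast?_append, List.getLast?_singleton, Option.some_or,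
            Option.mem_def, Option.some.injEq] at hp
          subst hp
          by_contra hcon
          refine h1 (hq.trans ?_)
          congr 1
          ext1
          · exact hpq.symm
          · exact Bool.eq_not.mpr (Ne.symm hcon)
        · unfold IsReduced at *
          rw [List.isChain_append]
          refine ⟨hA.isReduced, hinvred, ?_⟩
          intro p hp q hq hpq
          rw [hXs] at hq
          simp only [List.head?_cons, Option.mem_def, Option.some.injEq] at hq
          subst hq
          by_contra hcon
          refine h2 (hp.trans ?_)
          congr 1
          ext1
          · exact hpq
          · simpa using hcon
      have hBw : B = X ++ [s] ++ A ++ invRev (X ++ [s]) := by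
        have h3 : mk B = mk (X ++ [s] ++ A ++ invRev (X ++ [s])) := by
          rw [hconj, ← mul_mk, ← mul_mk, ← mul_mk, ← inv_mk, ← mul_mk]
        have := reduce.sound h3
        rwa [hB.isReduced.reduce_eq, hred.reduce_eq] at this
      obtain ⟨t, Y, hY⟩ : ∃ t Y, X ++ [s] = t :: Y := by
        cases X with
        | nil => exact ⟨s, [], rfl⟩
        | cons t Y => exact ⟨t, Y ++ [s], rfl⟩
      rw [hY] at hBw
      have hlast : B.getLast? = some (t.1, !t.2) := by
        rw [hBw]
        simp [invRev, List.getLast?_append, List.getLast?_cons]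
      have hhead : B.head? = some t := by
        rw [hBw]
        simp
      have := hB.2 _ hlast _ hhead rfl
      simp at this

theorem exists_isCyclicallyReduced_conj [DecidableEq α] (x : FreeGroup α) :
    ∃ (y : FreeGroup α) (A : List (α × Bool)), IsCyclicallyReduced A ∧ y * x = mk A * y := by
  refine ⟨(mk (reduceCyclically.conjugator x.toWord))⁻¹, reduceCyclically x.toWord,
    reduceCyclically.isCyclicallyReduced isReduced_toWord, ?_⟩
  have h := congrArg mk (reduceCyclically.conj_conjugator_reduceCyclically x.toWord)
  rw [← mul_mk, ← mul_mk, ← inv_mk, mk_toWord] at h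
  rw [inv_mul_eq_iff_eq_mul, ← mul_assoc]
  exact h.symm

theorem isConj_mk_of_isRotated {A B : List (α × Bool)} (h : A ~r B) : IsConj (mk A) (mk B) := by
  obtain ⟨k, hk, rfl⟩ := List.isRotated_iff_mod.mp h
  rw [List.rotate_eq_drop_append_take hk, isConj_iff]
  refine ⟨(mk (A.take k))⁻¹, ?_⟩
  nth_rewrite 2 [← List.take_append_drop k A]
  rw [← mul_mk, ← mul_mk]
  group

end CyclicWords

end FreeGroup

/-! ### Unbounded search. -/

section Search

variable {α β : Type*} [Primcodable α] [Primcodable β]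

/-- Decode a natural number and test the result against a decidable relation. -/
theorem ComputablePred.computable₂_decode_guard {p : α → β → Prop} [∀ a b, Decidable (p a b)]
    (hp : ComputablePred fun q : α × β => p q.1 q.2) :
    Computable₂ fun (a : α) (k : ℕ) =>
      (Encodable.decode (α := β) k).bind fun b => if p a b then some b else none := by
  refine Computable.option_bind (Computable.decode.comp Computable.snd) ?_
  have h := hp.decide.comp
    (Computable.pair (Computable.fst.comp (Computable.fst (α := α × ℕ) (β := β))) Computable.snd)
  refine (Computable.cond h (Computable.option_some.comp Computable.snd)
    (Computable.const none)).of_eq fun q => ?_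
  simp [Bool.cond_decide]

theorem ComputablePred.exists_re {p : α → β → Prop}
    (hp : ComputablePred fun q : α × β => p q.1 q.2) : REPred fun a => ∃ b, p a b := by
  classical
  have hc := hp.computable₂_decode_guard
  refine (Partrec.rfindOpt hc).dom_re.of_eq fun a => ?_
  rw [Nat.rfindOpt_dom]
  constructor
  · rintro ⟨k, b, hb⟩
    obtain ⟨b', -, h⟩ := Option.bind_eq_some_iff.mp hb
    by_cases hab : p a b'
    · exact ⟨b', hab⟩
    · simp [hab] at h
  · rintro ⟨b, hb⟩
    exact ⟨Encodable.encode b, b, by simp [hb]⟩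

/-- A computable choice function for a computable total relation whose values depend only on the
sections of the relation. -/
theorem ComputablePred.exists_computable_choice {p : α → β → Prop}
    (hp : ComputablePred fun q : α × β => p q.1 q.2) (htot : ∀ a, ∃ b, p a b) :
    ∃ f : α → β, Computable f ∧ (∀ a, p a (f a)) ∧
      ∀ a a', (∀ b, p a b ↔ p a' b) → f a = f a' := by
  classical
  let g : α → ℕ → Option β := fun a k =>
    (Encodable.decode (α := β) k).bind fun b => if p a b then some b else none
  have hc : Computable₂ g := hp.computable₂_decode_guard
  have hdom : ∀ a, (Nat.rfindOpt (g a)).Dom := by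
    intro a
    rw [Nat.rfindOpt_dom]
    obtain ⟨b, hb⟩ := htot a
    exact ⟨Encodable.encode b, b, by simp [g, hb]⟩
  refine ⟨fun a => (Nat.rfindOpt (g a)).get (hdom a),
    (Partrec.rfindOpt hc).of_eq_tot fun a => Part.get_mem _, fun a => ?_, fun a a' h => ?_⟩
  · obtain ⟨k, hk⟩ := Nat.rfindOpt_spec (Part.get_mem (hdom a))
    obtain ⟨b', -, h⟩ := Option.bind_eq_some_iff.mp hk
    by_cases hab : p a b'
    · rw [if_pos hab, Option.some.injEq] at h
      change p a ((Nat.rfindOpt (g a)).get (hdom a))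
      rwa [← h]
    · simp [hab] at h
  · have : g a = g a' := by
      funext k
      simp only [g, h]
    simp only [this]

theorem PrimrecPred.mem_set_finite {s : Set α} (hs : s.Finite) : PrimrecPred fun a => a ∈ s := by
  classical
  obtain ⟨t, rfl⟩ := hs.exists_finset_coe
  refine (PrimrecRel.comp (PrimrecRel.exists_mem_list (Primrec.eq (α := α)))
    (Primrec.const t.toList) Primrec.id).of_eq fun a => ?_
  simp

end Search

/-! ### Computability of word operations. -/

section Words

variable {n : ℕ}

theorem primrec_reduce : Primrec (FreeGroup.reduce : GroupWord n → GroupWord n) := by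
  have hstep : Primrec₂ fun (_ : GroupWord n) (q : (Fin n × Bool) × GroupWord n) =>
      if q.2.head? = some (q.1.1, !q.1.2) then q.2.tail else q.1 :: q.2 := by
    refine Primrec.ite (Primrec.eq.comp (Primrec.list_head?.comp (Primrec.snd.comp Primrec.snd))
      (Primrec.option_some.comp ?_)) (Primrec.list_tail.comp (Primrec.snd.comp Primrec.snd))
      (Primrec.list_cons.comp (Primrec.fst.comp Primrec.snd) (Primrec.snd.comp Primrec.snd))
    exact (Primrec.dom_finite fun s : Fin n × Bool => (s.1, !s.2)).comp
      (Primrec.fst.comp Primrec.snd)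
  refine (Primrec.list_foldr Primrec.id (Primrec.const []) hstep).of_eq fun L => ?_
  induction L with
  | nil => rfl
  | cons s L ih =>
    simp only [id, List.foldr_cons] at ih ⊢
    rw [ih, FreeGroup.reduce.cons]
    cases h : FreeGroup.reduce L with
    | nil => simp
    | cons t l =>
      by_cases hst : s.1 = t.1 ∧ s.2 = !t.2
      · simp [hst]
      · have : ¬ t = (s.1, !s.2) := by
          rintro rfl
          simp at hst
        simp [hst, this]

theorem primrec_invRev : Primrec (FreeGroup.invRev : GroupWord n → GroupWord n) := by
  unfold FreeGroup.invRev
  exact Primrec.list_reverse.comp (Primrec.list_map Primrec.id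
    ((Primrec.dom_finite fun s : Fin n × Bool => (s.1, !s.2)).comp Primrec.snd).to₂)

/-- Every endomorphism of a free group of finite rank is induced by a computable map of words. -/
theorem exists_primrec_map (θ : FreeGroup (Fin n) →* FreeGroup (Fin n)) :
    ∃ f : GroupWord n → GroupWord n, Primrec f ∧
      ∀ W, FreeGroup.mk (f W) = θ (FreeGroup.mk W) := by
  refine ⟨fun W => W.flatMap fun s => (θ (FreeGroup.mk [s])).toWord,
    Primrec.list_flatMap Primrec.id
      ((Primrec.dom_finite fun s : Fin n × Bool => (θ (FreeGroup.mk [s])).toWord).comp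
        Primrec.snd).to₂, fun W => ?_⟩
  induction W with
  | nil => simp [← FreeGroup.one_eq_mk]
  | cons s W ih =>
    have h : FreeGroup.mk (s :: W) = FreeGroup.mk [s] * FreeGroup.mk W := by
      rw [FreeGroup.mul_mk]; rfl
    rw [h, map_mul, ← ih]
    simp only [List.flatMap_cons, ← FreeGroup.mul_mk, FreeGroup.mk_toWord]

variable {γ : Type*} [Primcodable γ]

theorem PrimrecPred.mk_eq {f g : γ → GroupWord n} (hf : Primrec f) (hg : Primrec g) :
    PrimrecPred fun c => FreeGroup.mk (f c) = FreeGroup.mk (g c) :=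
  (Primrec.eq.comp (primrec_reduce.comp hf) (primrec_reduce.comp hg)).of_eq fun _ =>
    ⟨FreeGroup.reduce.exact, FreeGroup.reduce.sound⟩

theorem primrecPred_isReduced :
    PrimrecPred fun W : GroupWord n => FreeGroup.IsReduced W :=
  (Primrec.eq.comp primrec_reduce Primrec.id).of_eq fun _ =>
    FreeGroup.isReduced_iff_reduce_eq.symm

theorem primrecPred_isCyclicallyReduced :
    PrimrecPred fun W : GroupWord n => FreeGroup.IsCyclicallyReduced W :=
  (primrecPred_isReduced.comp (Primrec.list_append.comp Primrec.id Primrec.id)).of_eq fun _ =>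
    FreeGroup.isCyclicallyReduced_iff_isReduced_append_self.symm

theorem primrecRel_isRotated : PrimrecRel fun A B : GroupWord n => A ~r B := by
  have h : PrimrecRel fun (k : ℕ) (q : GroupWord n × GroupWord n) =>
      q.1.drop k ++ q.1.take k = q.2 :=
    Primrec.eq.comp (Primrec.list_append.comp
      (Primrec.list_drop.comp Primrec.fst (Primrec.fst.comp Primrec.snd))
      (Primrec.list_take.comp Primrec.fst (Primrec.fst.comp Primrec.snd)))
      (Primrec.snd.comp Primrec.snd)
  refine (PrimrecRel.comp (h.exists_mem_list) (Primrec.list_range.comp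
    (Primrec.succ.comp (Primrec.list_length.comp Primrec.fst))) Primrec.id).of_eq fun q => ?_
  simp only [List.mem_range, Nat.lt_succ_iff, id]
  rw [List.isRotated_iff_mod]
  refine exists_congr fun k => and_congr_right fun hk => ?_
  rw [List.rotate_eq_drop_append_take hk]

end Words

/-! ### Certificates and the decision procedure. -/

section TwistedConjugacy

variable {n : ℕ} {φ : MulAut (FreeGroup (Fin n))}

/-- Puts the equation in the form c⁻¹ * a * φ c, with c = X⁻¹ and a = U⁻¹, to which the twisted
power identities apply. -/
theorem map_mul_eq_mul_iff {G : Type*} [Group G] (φ : MulAut G) (X U V : G) :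
    φ X * U = V * X ↔ V⁻¹ = (X⁻¹)⁻¹ * U⁻¹ * φ X⁻¹ := by
  rw [inv_eq_iff_eq_inv, map_inv, eq_comm (a := V), ← mul_inv_eq_iff_eq_mul]
  simp only [mul_inv_rev, inv_inv, mul_assoc]

theorem TwistedConjugate.symm {U V : GroupWord n} (h : TwistedConjugate φ U V) :
    TwistedConjugate φ V U := by
  obtain ⟨X, hX⟩ := h
  refine ⟨X⁻¹, ?_⟩
  rw [map_inv, inv_mul_eq_iff_eq_mul, ← mul_assoc, hX, mul_inv_cancel_right]

theorem TwistedConjugate.trans {U V W : GroupWord n} (h : TwistedConjugate φ U V)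
    (h' : TwistedConjugate φ V W) : TwistedConjugate φ U W := by
  obtain ⟨X, hX⟩ := h
  obtain ⟨Y, hY⟩ := h'
  exact ⟨Y * X, by rw [map_mul, mul_assoc, hX, ← mul_assoc, hY, mul_assoc]⟩

theorem TwistedConjugate.toWord_mk (V : GroupWord n) :
    TwistedConjugate φ (FreeGroup.mk V).toWord V :=
  ⟨1, by simp [FreeGroup.mk_toWord, - FreeGroup.toWord_mk]⟩

theorem TwistedConjugate.exists_word {U V : GroupWord n} :
    TwistedConjugate φ U V ↔
      ∃ X : GroupWord n, φ (FreeGroup.mk X) * FreeGroup.mk U = FreeGroup.mk V * FreeGroup.mk X := by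
  constructor
  · rintro ⟨X, hX⟩
    exact ⟨X.toWord, by rwa [FreeGroup.mk_toWord]⟩
  · rintro ⟨X, hX⟩
    exact ⟨_, hX⟩

theorem exists_primrec_twistedPow (φ : MulAut (FreeGroup (Fin n))) (k : ℕ) :
    ∃ f : GroupWord n → GroupWord n, Primrec f ∧
      ∀ W, FreeGroup.mk (f W) = twistedPow φ (FreeGroup.mk W)⁻¹ k := by
  obtain ⟨p, hp, hpφ⟩ := exists_primrec_map φ.toMonoidHom
  induction k with
  | zero => exact ⟨fun _ => [], Primrec.const _, fun _ => rfl⟩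
  | succ k ih =>
    obtain ⟨f, hf, hfk⟩ := ih
    refine ⟨fun W => FreeGroup.invRev W ++ p (f W),
      Primrec.list_append.comp primrec_invRev (hp.comp hf), fun W => ?_⟩
    rw [← FreeGroup.mul_mk, ← FreeGroup.inv_mk, hpφ, hfk]
    rfl

variable {m : ℕ} {g : FreeGroup (Fin n)}

theorem mul_twistedPow_eq_of_map_mul_eq (hg : φ ^ m = MulAut.conj g)
    {X U V : FreeGroup (Fin n)} (h : φ X * U = V * X) :
    X * (twistedPow φ U⁻¹ m * g) = twistedPow φ V⁻¹ m * g * X := by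
  rw [map_mul_eq_mul_iff] at h
  rw [h, twistedPow_mul_conj hg]
  group

/-- If the twisted power of `U` is nontrivial, then whether `X` conjugates `U` to `V` does not
depend on the choice of `X` among the elements conjugating the twisted powers. -/
theorem map_mul_eq_of_twistedPow_ne (hg : φ ^ m = MulAut.conj g) (hφg : φ g = g)
    {X Y U V : FreeGroup (Fin n)} (hU : twistedPow φ U⁻¹ m * g ≠ 1)
    (hX : X * (twistedPow φ U⁻¹ m * g) = twistedPow φ V⁻¹ m * g * X)
    (hY : φ Y * U = V * Y) : φ X * U = V * X := by
  have hY' := mul_twistedPow_eq_of_map_mul_eq hg hY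
  set u := twistedPow φ U⁻¹ m * g with hu
  have hcomm : Commute (Y⁻¹ * X) u := by
    have : twistedPow φ V⁻¹ m * g = Y * u * Y⁻¹ := by rw [hY']; group
    rw [this] at hX
    unfold Commute SemiconjBy
    rw [mul_assoc, hX]
    group
  have hfix := FreeGroup.map_eq_of_commute
    (ψ := (MulAut.conj U⁻¹).toMonoidHom.comp φ.toMonoidHom) hU
    (twistedPow_mul_fixed hg hφg U⁻¹) hcomm
  have hr : U⁻¹ * φ (Y⁻¹ * X) * (U⁻¹)⁻¹ = Y⁻¹ * X := hfix
  have hV : V = φ Y * U * Y⁻¹ := by rw [hY]; group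
  rw [map_mul, map_inv] at hr
  have : φ X = φ Y * U * (Y⁻¹ * X) * U⁻¹ := by rw [← hr]; group
  rw [this, hV]
  group

theorem exists_twistedConjugate_length_le (hm : 0 < m) (hg : φ ^ m = MulAut.conj g) :
    ∃ C, ∀ U : GroupWord n, twistedPow φ (FreeGroup.mk U)⁻¹ m * g = 1 →
      ∃ W : GroupWord n, W.length ≤ C ∧ TwistedConjugate φ U W := by
  obtain ⟨C, hC⟩ := FreeGroup.exists_norm_twisted_conj_le hm hg
  refine ⟨C, fun U hU => ?_⟩
  obtain ⟨c, hc⟩ := hC _ hU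
  refine ⟨(c⁻¹ * (FreeGroup.mk U)⁻¹ * φ c)⁻¹.toWord, ?_, c⁻¹, ?_⟩
  · rwa [← FreeGroup.norm_inv_eq] at hc
  · rw [map_mul_eq_mul_iff, FreeGroup.mk_toWord, inv_inv, inv_inv, inv_inv]

/-- Certificates for words that are not twisted conjugate. The words in `bad` represent the finitely
many classes whose twisted power is trivial. -/
theorem not_twistedConjugate_iff (hg : φ ^ m = MulAut.conj g) (hφg : φ g = g)
    {C : ℕ} (hC : ∀ U : GroupWord n, twistedPow φ (FreeGroup.mk U)⁻¹ m * g = 1 →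
      ∃ W : GroupWord n, W.length ≤ C ∧ TwistedConjugate φ U W)
    {bad : Set (GroupWord n × GroupWord n)}
    (hbad : ∀ A B, (A, B) ∈ bad ↔ A.length ≤ C ∧ B.length ≤ C ∧ ¬ TwistedConjugate φ A B)
    {t : GroupWord n → GroupWord n}
    (ht : ∀ W, FreeGroup.mk (t W) = twistedPow φ (FreeGroup.mk W)⁻¹ m * g) (U V : GroupWord n) :
    ¬ TwistedConjugate φ U V ↔
      ∃ w : (GroupWord n × GroupWord n) × GroupWord n × GroupWord n,
      ((FreeGroup.IsCyclicallyReduced w.1.1 ∧ FreeGroup.IsCyclicallyReduced w.1.2 ∧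
        FreeGroup.mk (w.2.1 ++ t U) = FreeGroup.mk (w.1.1 ++ w.2.1) ∧
        FreeGroup.mk (w.2.2 ++ t V) = FreeGroup.mk (w.1.2 ++ w.2.2) ∧ ¬ w.1.1 ~r w.1.2) ∨
      (FreeGroup.mk (w.2.1 ++ t U) = FreeGroup.mk (t V ++ w.2.1) ∧
        FreeGroup.mk (t U) ≠ FreeGroup.mk [] ∧
        φ (FreeGroup.mk w.2.1) * FreeGroup.mk U ≠ FreeGroup.mk V * FreeGroup.mk w.2.1)) ∨
      (w.1 ∈ bad ∧
        φ (FreeGroup.mk w.2.1) * FreeGroup.mk U = FreeGroup.mk w.1.1 * FreeGroup.mk w.2.1 ∧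
        φ (FreeGroup.mk w.2.2) * FreeGroup.mk V = FreeGroup.mk w.1.2 * FreeGroup.mk w.2.2) := by
  simp only [← FreeGroup.mul_mk, ht]
  constructor
  · intro h
    -- Three obstructions: u and v are not conjugate; they are, u ≠ 1, and one conjugator fails; or
    -- u = v = 1 and short representatives are inequivalent.
    by_cases hconj : ∃ X, X * (twistedPow φ (FreeGroup.mk U)⁻¹ m * g) =
        twistedPow φ (FreeGroup.mk V)⁻¹ m * g * X
    · obtain ⟨X, hX⟩ := hconj
      by_cases hU : twistedPow φ (FreeGroup.mk U)⁻¹ m * g = 1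
      · have hV : twistedPow φ (FreeGroup.mk V)⁻¹ m * g = 1 := by
          rwa [hU, mul_one, eq_comm, mul_eq_right] at hX
        obtain ⟨A, hA, hUA⟩ := hC U hU
        obtain ⟨B, hB, hVB⟩ := hC V hV
        obtain ⟨Y, hY⟩ := TwistedConjugate.exists_word.mp hUA
        obtain ⟨Z, hZ⟩ := TwistedConjugate.exists_word.mp hVB
        exact ⟨((A, B), Y, Z), .inr ⟨(hbad A B).mpr
          ⟨hA, hB, fun hAB => h ((hUA.trans hAB).trans hVB.symm)⟩, hY, hZ⟩⟩
      · refine ⟨(([], []), X.toWord, []), .inl (.inr ⟨?_, hU, ?_⟩)⟩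
        · rw [FreeGroup.mk_toWord]
          exact hX
        · exact fun hcon => h ⟨_, hcon⟩
    · obtain ⟨X, A, hA, hXA⟩ := FreeGroup.exists_isCyclicallyReduced_conj
        (twistedPow φ (FreeGroup.mk U)⁻¹ m * g)
      obtain ⟨Y, B, hB, hYB⟩ := FreeGroup.exists_isCyclicallyReduced_conj
        (twistedPow φ (FreeGroup.mk V)⁻¹ m * g)
      refine ⟨((A, B), X.toWord, Y.toWord), .inl (.inl ⟨hA, hB, ?_, ?_, fun hrot => hconj ?_⟩)⟩
      · rw [FreeGroup.mk_toWord]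
        exact hXA
      · rw [FreeGroup.mk_toWord]
        exact hYB
      · obtain ⟨Z, hZ⟩ := isConj_iff.mp (FreeGroup.isConj_mk_of_isRotated hrot)
        refine ⟨Y⁻¹ * Z * X, ?_⟩
        calc _ = Y⁻¹ * Z * (X * (twistedPow φ (FreeGroup.mk U)⁻¹ m * g)) := mul_assoc _ _ _
          _ = Y⁻¹ * (Z * FreeGroup.mk A * Z⁻¹) * Y * (Y⁻¹ * Z * X) := by rw [hXA]; group
          _ = Y⁻¹ * (FreeGroup.mk B * Y) * (Y⁻¹ * Z * X) := by rw [hZ]; group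
          _ = _ := by rw [← hYB]; group
  · rintro ⟨⟨⟨A, B⟩, X, Y⟩, (⟨hA, hB, hX, hY, hrot⟩ | ⟨hX, hne, hneq⟩) | ⟨hAB, hX, hY⟩⟩ ⟨Z, hZ⟩
    · refine hrot (FreeGroup.isRotated_of_mul_eq_mul hA hB
        (X := (FreeGroup.mk Y * Z * (FreeGroup.mk X)⁻¹).toWord) FreeGroup.isReduced_toWord ?_)
      rw [FreeGroup.mk_toWord]
      have hZ' := mul_twistedPow_eq_of_map_mul_eq hg hZ
      dsimp only at hX hY
      rw [← mul_inv_eq_iff_eq_mul] at hX hY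
      rw [← hX, ← hY]
      have : ∀ x y u v z : FreeGroup (Fin n), z * u = v * z →
          y * z * x⁻¹ * (x * u * x⁻¹) = y * v * y⁻¹ * (y * z * x⁻¹) := by
        intro x y u v z h
        calc _ = y * (z * u) * x⁻¹ := by group
          _ = _ := by rw [h]; group
      exact this _ _ _ _ _ hZ'
    · exact hneq (map_mul_eq_of_twistedPow_ne hg hφg hne hX hZ)
    · exact ((hbad A B).mp hAB).2.2
        ((TwistedConjugate.symm ⟨_, hX⟩).trans (.trans ⟨Z, hZ⟩ ⟨_, hY⟩))

theorem computablePred_twistedConjugate (hφ : IsVirtuallyInner φ) :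
    ComputablePred fun p : GroupWord n × GroupWord n => TwistedConjugate φ p.1 p.2 := by
  obtain ⟨m, g, hm, hg, hφg⟩ := hφ.exists_fixed_conj
  obtain ⟨C, hC⟩ := exists_twistedConjugate_length_le hm hg
  obtain ⟨q, hq, hqφ⟩ := exists_primrec_map φ.toMonoidHom
  obtain ⟨t₀, ht₀, ht₀m⟩ := exists_primrec_twistedPow φ m
  let t : GroupWord n → GroupWord n := fun W => t₀ W ++ g.toWord
  have ht : Primrec t := Primrec.list_append.comp ht₀ (Primrec.const _)
  have htm : ∀ W, FreeGroup.mk (t W) = twistedPow φ (FreeGroup.mk W)⁻¹ m * g := fun W => by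
    simp only [t, ← FreeGroup.mul_mk, ht₀m, FreeGroup.mk_toWord]
  let bad : Set (GroupWord n × GroupWord n) :=
    {p | p.1.length ≤ C ∧ p.2.length ≤ C ∧ ¬ TwistedConjugate φ p.1 p.2}
  -- Finiteness alone makes membership decidable: the table exists, although it is not computed from
  -- φ.
  have hbad : bad.Finite :=
    ((List.finite_length_le (Fin n × Bool) C).prod (List.finite_length_le (Fin n × Bool) C)).subset
      fun p hp => ⟨hp.1, hp.2.1⟩
  have hsol : ∀ {γ : Type} [Primcodable γ] {X U V : γ → GroupWord n}, Primrec X → Primrec U →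
      Primrec V → PrimrecPred fun c =>
        φ (FreeGroup.mk (X c)) * FreeGroup.mk (U c) = FreeGroup.mk (V c) * FreeGroup.mk (X c) := by
    intro γ _ X U V hX hU hV
    refine (PrimrecPred.mk_eq (Primrec.list_append.comp (hq.comp hX) hU)
      (Primrec.list_append.comp hV hX)).of_eq fun c => ?_
    rw [← FreeGroup.mul_mk, ← FreeGroup.mul_mk, hqφ]
    rfl
  -- Post's theorem: search for a solution X and for a certificate of its absence.
  refine ComputablePred.computable_iff_re_compl_re'.mpr ⟨?_, ?_⟩
  · refine (ComputablePred.exists_re (p := fun (p : GroupWord n × GroupWord n) (X : GroupWord n) =>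
      φ (FreeGroup.mk X) * FreeGroup.mk p.1 = FreeGroup.mk p.2 * FreeGroup.mk X)
      (PrimrecPred.computablePred ?_)).of_eq fun p => TwistedConjugate.exists_word.symm
    exact hsol Primrec.snd (Primrec.fst.comp Primrec.fst) (Primrec.snd.comp Primrec.fst)
  · refine REPred.of_eq (ComputablePred.exists_re (PrimrecPred.computablePred ?_)) fun p =>
      (not_twistedConjugate_iff hg hφg hC (bad := bad) (fun _ _ => Iff.rfl) htm p.1 p.2).symm
    let γ := (GroupWord n × GroupWord n) × (GroupWord n × GroupWord n) × GroupWord n × GroupWord n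
    have hU : Primrec fun c : γ => c.1.1 := Primrec.fst.comp Primrec.fst
    have hV : Primrec fun c : γ => c.1.2 := Primrec.snd.comp Primrec.fst
    have hAB : Primrec fun c : γ => c.2.1 := Primrec.fst.comp Primrec.snd
    have hA : Primrec fun c : γ => c.2.1.1 := Primrec.fst.comp hAB
    have hB : Primrec fun c : γ => c.2.1.2 := Primrec.snd.comp hAB
    have hX : Primrec fun c : γ => c.2.2.1 :=
      Primrec.fst.comp (Primrec.snd.comp Primrec.snd)
    have hY : Primrec fun c : γ => c.2.2.2 :=
      Primrec.snd.comp (Primrec.snd.comp Primrec.snd)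
    have happ : ∀ {f h : γ → GroupWord n}, Primrec f → Primrec h → Primrec fun c => f c ++ h c :=
      fun hf hh => Primrec.list_append.comp hf hh
    refine PrimrecPred.or (PrimrecPred.or ?_ ?_) ?_
    · exact (primrecPred_isCyclicallyReduced.comp hA).and <|
        (primrecPred_isCyclicallyReduced.comp hB).and <|
        (PrimrecPred.mk_eq (happ hX (ht.comp hU)) (happ hA hX)).and <|
        (PrimrecPred.mk_eq (happ hY (ht.comp hV)) (happ hB hY)).and
        (primrecRel_isRotated.comp hA hB).not
    · exact (PrimrecPred.mk_eq (happ hX (ht.comp hU)) (happ (ht.comp hV) hX)).and <|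
        (PrimrecPred.mk_eq (ht.comp hU) (Primrec.const [])).not.and (hsol hX hU hV).not
    · exact ((PrimrecPred.mem_set_finite hbad).comp hAB).and <|
        (hsol hX hU hA).and (hsol hY hV hB)

end TwistedConjugacy

theorem theorem1 (n : ℕ) (φ : MulAut (FreeGroup (Fin n))) (hφ : IsVirtuallyInner φ) :
    TwistedConjugacyProblemSolvable {φ} ∧
      ∃ nf : GroupWord n → GroupWord n, Computable nf ∧ IsTwistedNormalForm φ nf := by
  have hdec := computablePred_twistedConjugate hφ
  refine ⟨hdec.of_eq fun p => by simp, ?_⟩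
  have hrel : ComputablePred fun q : GroupWord n × GroupWord n =>
      FreeGroup.IsReduced q.2 ∧ TwistedConjugate φ q.2 q.1 := by
    classical
    have h1 := (primrecPred_isReduced (n := n)).decide.to_comp.comp
      (Computable.snd (α := GroupWord n) (β := GroupWord n))
    have h2 := hdec.decide.comp (Computable.pair (Computable.snd (α := GroupWord n)
      (β := GroupWord n)) Computable.fst)
    refine ⟨inferInstance, (Primrec.and.to_comp.comp h1 h2).of_eq fun q => ?_⟩
    simp
  -- The search tests only membership in the class, so equivalent inputs return the same word.
  obtain ⟨nf, hnf, hspec, hinv⟩ := ComputablePred.exists_computable_choice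
    (p := fun V W => FreeGroup.IsReduced W ∧ TwistedConjugate φ W V) hrel
    fun V => ⟨_, FreeGroup.isReduced_toWord, TwistedConjugate.toWord_mk V⟩
  refine ⟨nf, hnf, fun V => (hspec V).1, fun V => (hspec V).2, fun U V => ⟨fun h => ?_, fun h => ?_⟩⟩
  · exact (hspec U).2.symm.trans (h ▸ (hspec V).2)
  · exact hinv U V fun W => and_congr_right fun _ => ⟨fun h' => h'.trans h, fun h' => h'.trans h.symm⟩
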